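/- Let $E$ be a complex vector bundle of finite rank $n$ over a topological space $M$. Let $c_k(E)\in H^{2k}(M;\mathbb Q)$ be its rational Chern classes (with $c_0(E)=1$ and $c_k(E)=0$ for $k>n$), and let $c(E)=\sum_{k\ge 0}c_k(E)\in\prod_{k\ge 0} H^{k}(M;\mathbb Q)$ be its total Chern class. Let $\mathrm{ch}(E)=\sum_{k\ge 0}\frac{1}{k!}s_k\big(c_1(E),\dots,c_n(E)\big)\in\prod_{k\ge 0} H^{k}(M;\mathbb Q)$ be its Chern character, where $s_k$ is the polynomial expressing the power sum $x_1^k+\dots+x_n^k$ in the elementary symmetric polynomials of $x_1,\dots,x_n$ (equivalently, $\mathrm{ch}(E)=\sum_{j=1}^n e^{x_j}$ in the Chern roots $x_j$ of $E$). Call $E$ exponential if $c(E)=e^{c_1(E)}$ or, equivalently, if $c_k(E)=\frac{1}{k!}c_1(E)^k$ for all $k\ge 0$. Then $E$ is exponential if and only if $\mathrm{ch}(E)\in H^0(M;\mathbb Q)\oplus H^2(M;\mathbb Q)$. -/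

import Mathlib

set_option linter.unusedSectionVars false

namespace SingCoh
open CategoryTheory Opposite Simplicial
universe u u' v

/-- The order preserving map `[m] → [n]`, `j ↦ a + j` (it is only used when `a + m ≤ n`; the
`min` makes it total). `slice 0 p n` is the front `p`-face and `slice p q (p + q)` the back
`q`-face. -/
def slice (a m n : ℕ) : (⦋m⦌ : SimplexCategory) ⟶ ⦋n⦌ :=
  SimplexCategory.mkHom
    { toFun := fun j => ⟨min (a + j) n, by omega⟩
      monotone' := fun i j h => by
        have : (i : ℕ) ≤ j := h
        simp only [Fin.mk_le_mk]; omega }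

/-- Total cochains of a simplicial set with coefficients in `R`: the product over all `n` of the
modules of functions on the `n`-simplices. -/
def Cochain (R : Type v) (S : SSet.{u}) : Type (max u v) := ∀ n : ℕ, S.obj (op ⦋n⦌) → R

variable {R : Type v} {S : SSet.{u}}

noncomputable section

@[ext] lemma Cochain.ext {f g : Cochain R S} (h : ∀ n σ, f n σ = g n σ) : f = g := by
  funext n σ; exact h n σ
variable [CommRing R]

instance : AddCommGroup (Cochain R S) :=
  inferInstanceAs (AddCommGroup (∀ n : ℕ, S.obj (op ⦋n⦌) → R))
instance : Module R (Cochain R S) :=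
  inferInstanceAs (Module R (∀ n : ℕ, S.obj (op ⦋n⦌) → R))

@[simp] lemma Cochain.add_apply (f g : Cochain R S) (n : ℕ) (σ) : (f + g) n σ = f n σ + g n σ := rfl
@[simp] lemma Cochain.zero_apply (n : ℕ) (σ) : (0 : Cochain R S) n σ = 0 := rfl
@[simp] lemma Cochain.smul_apply (r : R) (f : Cochain R S) (n : ℕ) (σ) : (r • f) n σ = r * f n σ := rfl

/-- The cup product: `(f ∪ g)(σ) = ∑_{p+q=n} f_p(front p-face of σ) * g_q(back q-face of σ)`. -/
instance : Mul (Cochain R S) where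
  mul f g := fun n σ => ∑ p ∈ Finset.HasAntidiagonal.antidiagonal n,
    f p.1 (S.map (slice 0 p.1 n).op σ) * g p.2 (S.map (slice p.1 p.2 n).op σ)

instance : One (Cochain R S) where
  one := fun n _ => if n = 0 then 1 else 0

lemma Cochain.mul_apply (f g : Cochain R S) (n : ℕ) (σ) : (f * g) n σ =
    ∑ p ∈ Finset.HasAntidiagonal.antidiagonal n,
    f p.1 (S.map (slice 0 p.1 n).op σ) * g p.2 (S.map (slice p.1 p.2 n).op σ) := rfl
lemma Cochain.one_apply (n : ℕ) (σ) : (1 : Cochain R S) n σ = if n = 0 then 1 else 0 := rfl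

lemma slice_apply (a m n : ℕ) (j : Fin (m + 1)) :
    (((slice a m n).toOrderHom j : Fin (n + 1)) : ℕ) = min (a + j) n := rfl

lemma slice_self (n : ℕ) : slice 0 n n = 𝟙 _ := by
  apply SimplexCategory.Hom.ext
  ext j : 2
  apply Fin.ext
  have : (j : ℕ) < n + 1 := j.2
  rw [slice_apply]
  simp
  omega

lemma slice_comp (a b m k n : ℕ) (h : a + m ≤ k) :
    slice a m k ≫ slice b k n = slice (b + a) m n := by
  apply SimplexCategory.Hom.ext
  ext j : 2
  apply Fin.ext
  have : (j : ℕ) < m + 1 := j.2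
  rw [SimplexCategory.comp_toOrderHom, OrderHom.comp_coe, Function.comp, slice_apply, slice_apply,
    slice_apply]
  omega

lemma map_slice_slice (a b m k n : ℕ) (h : a + m ≤ k) (σ : S.obj (op ⦋n⦌)) :
    S.map (slice a m k).op (S.map (slice b k n).op σ) = S.map (slice (b + a) m n).op σ := by
  rw [← slice_comp a b m k n h, op_comp, Functor.map_comp_apply]

instance : Ring (Cochain R S) where
  left_distrib f g h := by
    ext n σ; simp [Cochain.mul_apply, mul_add, Finset.sum_add_distrib]
  right_distrib f g h := by
    ext n σ; simp [Cochain.mul_apply, add_mul, Finset.sum_add_distrib]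
  zero_mul f := by ext n σ; simp [Cochain.mul_apply]
  mul_zero f := by ext n σ; simp [Cochain.mul_apply]
  one_mul f := by
    ext n σ
    rw [Cochain.mul_apply, Finset.sum_eq_single (0, n)]
    · simp [Cochain.one_apply, slice_self]
    · rintro ⟨a, b⟩ h1 h2
      rcases Nat.eq_zero_or_pos a with rfl | ha
      · simp_all
      · simp [Cochain.one_apply, ha.ne']
    · simp
  mul_one f := by
    ext n σ
    rw [Cochain.mul_apply, Finset.sum_eq_single (n, 0)]
    · simp [Cochain.one_apply, slice_self]
    · rintro ⟨a, b⟩ h1 h2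
      rcases Nat.eq_zero_or_pos b with rfl | ha
      · simp_all
      · simp [Cochain.one_apply, ha.ne']
    · simp
  mul_assoc f g h := by
    ext n σ
    simp only [Cochain.mul_apply, Finset.sum_mul, Finset.mul_sum]
    rw [Finset.sum_sigma', Finset.sum_sigma']
    refine Finset.sum_nbij' (fun x => ⟨(x.2.1, x.2.2 + x.1.2), (x.2.2, x.1.2)⟩)
      (fun x => ⟨(x.1.1 + x.2.1, x.2.2), (x.1.1, x.2.1)⟩) ?_ ?_ ?_ ?_ ?_
    · rintro ⟨⟨a, b⟩, c, e⟩ h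
      simp at h ⊢; omega
    · rintro ⟨⟨a, b⟩, c, e⟩ h
      simp at h ⊢; omega
    · rintro ⟨⟨a, b⟩, c, e⟩ h
      simp at h ⊢; omega
    · rintro ⟨⟨a, b⟩, c, e⟩ h
      simp at h ⊢; omega
    · rintro ⟨⟨a, b⟩, c, e⟩ h
      rw [Finset.mem_sigma, Finset.HasAntidiagonal.mem_antidiagonal, Finset.HasAntidiagonal.mem_antidiagonal] at h
      obtain ⟨h1, h2⟩ := h
      dsimp only at h1 h2 ⊢
      rw [map_slice_slice _ _ _ _ _ (by omega), map_slice_slice _ _ _ _ _ (by omega),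
        map_slice_slice _ _ _ _ _ (by omega), map_slice_slice _ _ _ _ _ (by omega), mul_assoc]
      simp [h2]
  neg_add_cancel f := by ext n σ; exact neg_add_cancel (f n σ)
  sub_eq_add_neg f g := sub_eq_add_neg f g
  zsmul := (fun n f => n • f)
  zsmul_zero' f := zero_zsmul f
  zsmul_succ' n f := SubNegMonoid.zsmul_succ' n f
  zsmul_neg' n f := SubNegMonoid.zsmul_neg' n f

instance : Algebra R (Cochain R S) :=
  Algebra.ofModule
    (fun r f g => by ext n σ; simp [Cochain.mul_apply, Finset.mul_sum, mul_assoc])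
    (fun r f g => by ext n σ; simp [Cochain.mul_apply, Finset.mul_sum, mul_left_comm])

/-- The simplicial coboundary `(df)(σ) = ∑ i, (-1)^i f(δᵢ σ)`. -/
def dFun (f : Cochain R S) : Cochain R S := fun n => match n with
  | 0 => fun _ => 0
  | n + 1 => fun σ => ∑ i : Fin (n + 2), (-1) ^ (i : ℕ) * f n (S.δ i σ)

/-- The coboundary as a linear map. -/
def d : Cochain R S →ₗ[R] Cochain R S where
  toFun := dFun
  map_add' f g := by
    ext n σ
    cases n <;> simp [dFun, mul_add, Finset.sum_add_distrib]
  map_smul' r f := by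
    ext n σ
    cases n <;> simp [dFun, Finset.mul_sum, mul_left_comm]

@[simp] lemma d_zero_apply (f : Cochain R S) (σ) : d f 0 σ = 0 := rfl
lemma d_succ_apply (f : Cochain R S) (n : ℕ) (σ) :
    d f (n + 1) σ = ∑ i : Fin (n + 2), (-1) ^ (i : ℕ) * f n (S.δ i σ) := rfl


/-- The sign involution, `(-1)^n` in degree `n`. -/
def sgn (f : Cochain R S) : Cochain R S := fun n σ => (-1) ^ n * f n σ

/-- The `i`-th coface `[n] → [n+1]`, indexed by a natural number. -/
def coface (i n : ℕ) : (⦋n⦌ : SimplexCategory) ⟶ ⦋n + 1⦌ :=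
  SimplexCategory.mkHom
    { toFun := fun j => ⟨if (j : ℕ) < i then (j : ℕ) else (j : ℕ) + 1, by split <;> omega⟩
      monotone' := fun k j h => by
        have : (k : ℕ) ≤ j := h
        simp only [Fin.mk_le_mk]; split <;> split <;> omega }

lemma coface_apply (i n : ℕ) (j : Fin (n + 1)) :
    (((coface i n).toOrderHom j : Fin (n + 2)) : ℕ) =
      if (j : ℕ) < i then (j : ℕ) else (j : ℕ) + 1 := rfl

lemma d_succ_apply' (f : Cochain R S) (n : ℕ) (σ) : d f (n + 1) σ =
    ∑ i ∈ Finset.range (n + 2), (-1) ^ i * f n (S.map (coface i n).op σ) := by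
  rw [d_succ_apply, ← Fin.sum_univ_eq_sum_range
    (fun i => (-1) ^ i * f n (S.map (coface i n).op σ))]
  refine Finset.sum_congr rfl fun i _ => ?_
  have : SimplexCategory.δ i = coface i n := by
    apply SimplexCategory.Hom.ext
    ext j : 2
    apply Fin.ext
    rw [coface_apply]
    simp [SimplexCategory.δ, Fin.succAbove, Fin.lt_def]
    split <;> simp
  rw [← this]
  rfl

lemma hom_ext' {m n : ℕ} {φ ψ : (⦋m⦌ : SimplexCategory) ⟶ ⦋n⦌}
    (h : ∀ j : Fin (m + 1), ((φ.toOrderHom j : Fin (n + 1)) : ℕ) = (ψ.toOrderHom j : Fin (n + 1))) :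
    φ = ψ := by
  apply SimplexCategory.Hom.ext
  ext j : 2
  exact Fin.ext (h j)

lemma map_map {k m n : ℕ} (φ : (⦋k⦌ : SimplexCategory) ⟶ ⦋m⦌) (ψ : (⦋m⦌ : SimplexCategory) ⟶ ⦋n⦌)
    (σ : S.obj (op ⦋n⦌)) : S.map φ.op (S.map ψ.op σ) = S.map (φ ≫ ψ).op σ := by
  rw [op_comp, Functor.map_comp_apply]

/-- The Leibniz rule. -/
lemma d_mul (f g : Cochain R S) : d (f * g) = d f * g + sgn f * d g := by
  ext n σ
  rcases n with _ | n
  · simp [Cochain.mul_apply]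
  · rw [d_succ_apply', Cochain.add_apply, Cochain.mul_apply, Cochain.mul_apply,
      Finset.Nat.sum_antidiagonal_succ, Finset.Nat.sum_antidiagonal_succ']
    simp only [d_zero_apply, zero_mul, mul_zero, zero_add, Cochain.mul_apply, d_succ_apply', sgn]
    simp only [Finset.mul_sum, Finset.sum_mul]
    rw [Finset.sum_comm, ← Finset.sum_add_distrib]
    refine Finset.sum_congr rfl ?_
    rintro ⟨p, q⟩ hpq
    rw [Finset.HasAntidiagonal.mem_antidiagonal] at hpq
    dsimp only at hpq ⊢
    subst hpq
    simp only [map_map]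
    rw [show p + q + 2 = (p + 1) + (q + 1) by ring, Finset.sum_range_add,
      Finset.sum_range_succ _ (p + 1), Finset.sum_range_succ' _ (q + 1)]
    have e1 : coface (p + 1) p ≫ slice 0 (p + 1) (p + q + 1) = slice 0 p (p + q + 1) := by
      refine hom_ext' fun j => ?_
      have : (j : ℕ) < p + 1 := j.2
      simp [slice_apply, coface_apply]
      split <;> omega
    have e2 : coface 0 q ≫ slice p (q + 1) (p + q + 1) = slice (p + 1) q (p + q + 1) := by
      refine hom_ext' fun j => ?_
      have : (j : ℕ) < q + 1 := j.2
      simp [slice_apply, coface_apply]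
      omega
    rw [e1, e2]
    have h1 : ∀ x ∈ Finset.range (p + 1),
        (-1) ^ x * (f p (S.map (slice 0 p (p + q) ≫ coface x (p + q)).op σ) *
          g q (S.map (slice p q (p + q) ≫ coface x (p + q)).op σ)) =
        (-1) ^ x * f p (S.map (coface x p ≫ slice 0 (p + 1) (p + q + 1)).op σ) *
          g q (S.map (slice (p + 1) q (p + q + 1)).op σ) := by
      intro x hx
      rw [Finset.mem_range] at hx
      have a1 : slice 0 p (p + q) ≫ coface x (p + q) =
          coface x p ≫ slice 0 (p + 1) (p + q + 1) := by
        refine hom_ext' fun j => ?_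
        have : (j : ℕ) < p + 1 := j.2
        simp [slice_apply, coface_apply]
        split <;> split <;> omega
      have a2 : slice p q (p + q) ≫ coface x (p + q) = slice (p + 1) q (p + q + 1) := by
        refine hom_ext' fun j => ?_
        have : (j : ℕ) < q + 1 := j.2
        simp [slice_apply, coface_apply]
        grind
      rw [a1, a2, mul_assoc]
    have h2 : ∀ x ∈ Finset.range (q + 1),
        (-1) ^ (p + 1 + x) * (f p (S.map (slice 0 p (p + q) ≫ coface (p + 1 + x) (p + q)).op σ) *
          g q (S.map (slice p q (p + q) ≫ coface (p + 1 + x) (p + q)).op σ)) =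
        (-1) ^ p * f p (S.map (slice 0 p (p + q + 1)).op σ) *
          ((-1) ^ (x + 1) * g q (S.map (coface (x + 1) q ≫ slice p (q + 1) (p + q + 1)).op σ)) := by
      intro x hx
      rw [Finset.mem_range] at hx
      have a1 : slice 0 p (p + q) ≫ coface (p + 1 + x) (p + q) = slice 0 p (p + q + 1) := by
        refine hom_ext' fun j => ?_
        have : (j : ℕ) < p + 1 := j.2
        simp [slice_apply, coface_apply]
        split <;> omega
      have a2 : slice p q (p + q) ≫ coface (p + 1 + x) (p + q) =
          coface (x + 1) q ≫ slice p (q + 1) (p + q + 1) := by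
        refine hom_ext' fun j => ?_
        have : (j : ℕ) < q + 1 := j.2
        simp [slice_apply, coface_apply]
        grind
      rw [a1, a2]
      ring
    rw [Finset.sum_congr rfl h1, Finset.sum_congr rfl h2]
    ring


lemma d_d (f : Cochain R S) : d (d f) = 0 := by
  ext n σ
  rcases n with _ | _ | n
  · rfl
  · rw [d_succ_apply]; simp
  · simp only [d_succ_apply', Finset.mul_sum, map_map, Cochain.zero_apply]
    rw [← Finset.sum_product']
    refine Finset.sum_involution
      (fun x _ => if x.2 < x.1 then (x.2, x.1 - 1) else (x.2 + 1, x.1)) ?_ ?_ ?_ ?_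
    · rintro ⟨j, i⟩ hx
      rw [Finset.mem_product, Finset.mem_range, Finset.mem_range] at hx
      dsimp only at hx ⊢
      by_cases h : i < j
      · rw [if_pos h]
        have e : coface i n ≫ coface j (n + 1) = coface (j - 1) n ≫ coface i (n + 1) := by
          refine hom_ext' fun k => ?_
          have : (k : ℕ) < n + 1 := k.2
          simp [coface_apply]
          grind
        obtain ⟨j, rfl⟩ : ∃ m, j = m + 1 := ⟨j - 1, by omega⟩
        rw [e]
        simp only [Nat.add_sub_cancel]
        ring
      · rw [if_neg h]
        have e : coface j n ≫ coface (i + 1) (n + 1) = coface i n ≫ coface j (n + 1) := by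
          refine hom_ext' fun k => ?_
          have : (k : ℕ) < n + 1 := k.2
          simp [coface_apply]
          grind
        rw [e]
        ring
    · rintro ⟨j, i⟩ hx _ h
      dsimp only at h
      split_ifs at h <;> simp only [Prod.mk.injEq] at h <;> omega
    · rintro ⟨j, i⟩ hx
      rw [Finset.mem_product, Finset.mem_range, Finset.mem_range] at hx
      dsimp only at hx ⊢
      split_ifs <;> simp only [Finset.mem_product, Finset.mem_range] <;> omega
    · rintro ⟨j, i⟩ hx
      rw [Finset.mem_product, Finset.mem_range, Finset.mem_range] at hx
      dsimp only at hx ⊢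
      by_cases h : i < j
      · simp only [if_pos h, if_neg (show ¬ j - 1 < i by omega), Prod.mk.injEq, and_true]
        omega
      · simp only [if_neg h, if_pos (show j < i + 1 by omega), Nat.add_sub_cancel]

lemma sgn_sgn (f : Cochain R S) : sgn (sgn f) = f := by
  ext n σ
  simp [sgn, ← mul_assoc, ← mul_pow]

lemma d_sgn (f : Cochain R S) : d (sgn f) = - sgn (d f) := by
  ext n σ
  rcases n with _ | n
  · change (0 : R) = - ((-1) ^ 0 * 0); simp
  · change _ = - ((-1) ^ (n + 1) * d f (n + 1) σ)
    simp only [d_succ_apply, sgn, Finset.mul_sum, ← Finset.sum_neg_distrib]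
    refine Finset.sum_congr rfl fun i _ => ?_
    ring

lemma d_one : d (1 : Cochain R S) = 0 := by
  ext n σ
  rcases n with _ | _ | n
  · rfl
  · simp [d_succ_apply, Cochain.one_apply, Fin.sum_univ_two]
  · simp [d_succ_apply, Cochain.one_apply]

variable (R S) in
/-- The algebra of cocycles. -/
def cocycles : Subalgebra R (Cochain R S) where
  carrier := {f | d f = 0}
  mul_mem' {f g} (hf : d f = 0) (hg : d g = 0) := by
    change d (f * g) = 0
    rw [d_mul, hf, hg, zero_mul, mul_zero, add_zero]
  add_mem' {f g} (hf : d f = 0) (hg : d g = 0) := by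
    change d (f + g) = 0
    rw [map_add, hf, hg, add_zero]
  algebraMap_mem' r := by
    change d (algebraMap R _ r) = 0
    rw [Algebra.algebraMap_eq_smul_one, map_smul, d_one, smul_zero]

lemma mem_cocycles (f : Cochain R S) : f ∈ cocycles R S ↔ d f = 0 := Iff.rfl

variable (R S) in
/-- The two-sided ideal of coboundaries in the algebra of cocycles. -/
def coboundaries : Ideal (cocycles R S) where
  carrier := {z | ∃ g : Cochain R S, d g = z}
  add_mem' := by
    rintro _ _ ⟨g, hg⟩ ⟨h, hh⟩
    exact ⟨g + h, by rw [map_add, hg, hh]; rfl⟩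
  zero_mem' := ⟨0, map_zero _⟩
  smul_mem' := by
    rintro z w ⟨g, hg⟩
    refine ⟨sgn z * g, ?_⟩
    have hz : d (z : Cochain R S) = 0 := z.2
    have h0 : sgn (0 : Cochain R S) = 0 := by ext n σ; simp [sgn]
    rw [d_mul, d_sgn, hz, h0, sgn_sgn, hg]
    simp

instance : (coboundaries R S).IsTwoSided where
  mul_mem_of_left := by
    rintro w z ⟨g, hg⟩
    refine ⟨g * z, ?_⟩
    have hz : d (z : Cochain R S) = 0 := z.2
    rw [d_mul, hg, hz, mul_zero, add_zero]
    rfl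

variable (R S) in
/-- Total cohomology `∏ n, H^n(S; R)` with its cup product: cocycles modulo coboundaries. As the
cochains are the product over all degrees, infinite sums of classes of distinct degrees are allowed. -/
def SimplicialCohomology : Type (max u v) := cocycles R S ⧸ coboundaries R S

instance : Ring (SimplicialCohomology R S) :=
  inferInstanceAs (Ring (cocycles R S ⧸ coboundaries R S))

instance : Algebra R (SimplicialCohomology R S) :=
  inferInstanceAs (Algebra R (cocycles R S ⧸ coboundaries R S))

/-- The cohomology class of a cocycle. -/
def classOf : cocycles R S →ₐ[R] SimplicialCohomology R S :=
  Ideal.Quotient.mkₐ R (coboundaries R S)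

lemma classOf_surjective :
    Function.Surjective (classOf : cocycles R S → SimplicialCohomology R S) :=
  Ideal.Quotient.mk_surjective

lemma classOf_eq_iff (z w : cocycles R S) :
    classOf z = classOf w ↔ ∃ g : Cochain R S, d g = z - w :=
  Ideal.Quotient.eq

/-- A cocycle representing a cohomology class. -/
def representative (x : SimplicialCohomology R S) : cocycles R S := (classOf_surjective x).choose

lemma classOf_representative (x : SimplicialCohomology R S) : classOf (representative x) = x :=
  (classOf_surjective x).choose_spec

/-- A simplicial map between simplicial sets that may live in different universes. -/
structure SimplicialMap (S : SSet.{u}) (T : SSet.{u'}) where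
  /-- the maps on simplices -/
  app : ∀ k : SimplexCategoryᵒᵖ, S.obj k → T.obj k
  naturality : ∀ {k l : SimplexCategoryᵒᵖ} (α : k ⟶ l) (σ : S.obj k),
    app l (S.map α σ) = T.map α (app k σ)

variable {T : SSet.{u'}}

def Cochain.mapFun (φ : SimplicialMap S T) (f : Cochain R T) : Cochain R S :=
  fun n σ => f n (φ.app (op ⦋n⦌) σ)

lemma Cochain.mapFun_apply (φ : SimplicialMap S T) (f : Cochain R T) (n : ℕ) (σ) :
    Cochain.mapFun φ f n σ = f n (φ.app (op ⦋n⦌) σ) := rfl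

/-- The homomorphism of cochain algebras induced by a simplicial map. -/
def Cochain.map (φ : SimplicialMap S T) : Cochain R T →ₐ[R] Cochain R S where
  toFun := Cochain.mapFun φ
  map_one' := rfl
  map_mul' f g := by
    ext n σ
    simp [Cochain.mul_apply, Cochain.mapFun_apply, φ.naturality]
  map_zero' := rfl
  map_add' f g := rfl
  commutes' r := by
    rw [Algebra.algebraMap_eq_smul_one, Algebra.algebraMap_eq_smul_one]
    rfl

lemma Cochain.map_apply (φ : SimplicialMap S T) (f : Cochain R T) (n : ℕ) (σ) :
    Cochain.map φ f n σ = f n (φ.app (op ⦋n⦌) σ) := rfl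

lemma d_map (φ : SimplicialMap S T) (f : Cochain R T) :
    d (Cochain.map φ f) = Cochain.map φ (d f) := by
  ext n σ
  rcases n with _ | n
  · rfl
  · simp [d_succ_apply', Cochain.map_apply, φ.naturality]

/-- The induced map on cocycles. -/
def cocyclesMap (φ : SimplicialMap S T) : cocycles R T →ₐ[R] cocycles R S :=
  ((Cochain.map φ).comp (cocycles R T).val).codRestrict (cocycles R S) fun z => by
    have hz : d (z : Cochain R T) = 0 := z.2
    change d (Cochain.map φ (z : Cochain R T)) = 0
    rw [d_map, hz, map_zero]

/-- The homomorphism of cohomology algebras induced by a simplicial map. -/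
def pullback (φ : SimplicialMap S T) : SimplicialCohomology R T →ₐ[R] SimplicialCohomology R S :=
  Ideal.quotientMapₐ (coboundaries R S) (cocyclesMap φ) (by
    rintro z ⟨g, hg⟩
    exact ⟨Cochain.map φ g, by rw [d_map, hg]; rfl⟩)

lemma pullback_classOf (φ : SimplicialMap S T) (z : cocycles R T) :
    pullback φ (classOf z) = classOf (cocyclesMap φ z) := rfl

variable (R S) in
/-- `H^n(S; R)` as a submodule of the total cohomology: the classes of cocycles concentrated in
degree `n`. -/
def degreePart (n : ℕ) : Submodule R (SimplicialCohomology R S) :=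
  Submodule.map (classOf (R := R) (S := S)).toLinearMap
    { carrier := {z | ∀ m, m ≠ n → (z : Cochain R S) m = 0}
      add_mem' := fun {a b} ha hb m hm => by
        change (a : Cochain R S) m + (b : Cochain R S) m = 0
        rw [ha m hm, hb m hm, add_zero]
      zero_mem' := fun m hm => rfl
      smul_mem' := fun r a ha m hm => by
        change r • (a : Cochain R S) m = 0
        rw [ha m hm, smul_zero] }

/-- The cochain whose degree `n` component is that of `z n`. -/
def diagFun (z : ℕ → cocycles R S) : Cochain R S := fun n => (z n : Cochain R S) n

/-- The cocycle whose degree `n` component is that of `z n`. -/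
def diag (z : ℕ → cocycles R S) : cocycles R S :=
  ⟨diagFun z, by
    rw [mem_cocycles]
    ext n σ
    rcases n with _ | n
    · rfl
    · have h : d (z n : Cochain R S) = 0 := (z n).2
      have h2 : d (z n : Cochain R S) (n + 1) σ = 0 := by rw [h]; rfl
      exact h2⟩

/-- The possibly infinite sum `∑ n, (a n)_n`, that is, the element of `∏ n, H^n` whose degree `n`
component is that of `a n`. It does not depend on the representatives, see `total_classOf`. -/
def total (a : ℕ → SimplicialCohomology R S) : SimplicialCohomology R S :=
  classOf (diag fun n => representative (a n))

/-- Component indices only matter up to the previous degree. -/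
lemma d_congr {f g : Cochain R S} {n : ℕ} (h : f n = g n) : d f (n + 1) = d g (n + 1) := by
  funext σ; rw [d_succ_apply, d_succ_apply, h]

/-- The cochain with degree `n` component that of `g (n + 1)`. -/
def glue (g : ℕ → Cochain R S) : Cochain R S := fun n => g (n + 1) n

lemma d_glue (g : ℕ → Cochain R S) (n : ℕ) : d (glue g) n = d (g n) n := by
  cases n with
  | zero => rfl
  | succ n => exact d_congr rfl

lemma total_classOf (z : ℕ → cocycles R S) :
    total (fun n => classOf (z n)) = classOf (diag z) := by
  have h : ∀ n, ∃ g : Cochain R S, d g = representative (classOf (z n)) - z n := by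
    intro n
    rw [← classOf_eq_iff, classOf_representative]
  choose g hg using h
  rw [total, classOf_eq_iff]
  refine ⟨glue g, ?_⟩
  funext n
  rw [d_glue, hg]
  rfl

lemma total_const (x : SimplicialCohomology R S) : total (fun _ => x) = x := by
  obtain ⟨z, rfl⟩ := classOf_surjective x
  rw [total_classOf]
  rfl

lemma mem_degreePart {n : ℕ} {x : SimplicialCohomology R S} : x ∈ degreePart R S n ↔
    ∃ z : cocycles R S, (∀ m, m ≠ n → (z : Cochain R S) m = 0) ∧ classOf z = x :=
  Iff.rfl

/-- The part of `g` in degree `n - 1`. -/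
def shiftOnly (n : ℕ) (g : Cochain R S) : Cochain R S := fun m => if m + 1 = n then g m else 0

lemma total_injective {a b : ℕ → SimplicialCohomology R S}
    (ha : ∀ n, a n ∈ degreePart R S n) (hb : ∀ n, b n ∈ degreePart R S n) :
    total a = total b ↔ a = b := by
  refine ⟨fun h => ?_, fun h => h ▸ rfl⟩
  choose z hz hza using fun n => mem_degreePart.1 (ha n)
  choose w hw hwb using fun n => mem_degreePart.1 (hb n)
  obtain rfl : (fun n => classOf (z n)) = a := funext hza
  obtain rfl : (fun n => classOf (w n)) = b := funext hwb
  rw [total_classOf, total_classOf, classOf_eq_iff] at h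
  obtain ⟨g, hg⟩ := h
  funext n
  rw [classOf_eq_iff]
  refine ⟨shiftOnly n g, ?_⟩
  funext m
  by_cases hm : m = n
  · subst hm
    rcases m with _ | m
    · have := congrFun hg 0
      exact this
    · rw [d_congr (show shiftOnly (m + 1) g m = g m from if_pos rfl), hg]
      rfl
  · have h0 : ((z n : Cochain R S) - (w n : Cochain R S)) m = 0 := by
      change (z n : Cochain R S) m - (w n : Cochain R S) m = 0
      rw [hz n m hm, hw n m hm, sub_zero]
    rw [h0]
    rcases m with _ | m
    · rfl
    · rw [d_congr (show shiftOnly n g m = (0 : Cochain R S) m from if_neg hm), map_zero]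
      rfl

lemma one_mem_degreePart : (1 : SimplicialCohomology R S) ∈ degreePart R S 0 :=
  mem_degreePart.2 ⟨1, fun m hm => by funext σ; exact if_neg hm, rfl⟩

lemma mul_mem_degreePart {p q : ℕ} {x y : SimplicialCohomology R S}
    (hx : x ∈ degreePart R S p) (hy : y ∈ degreePart R S q) : x * y ∈ degreePart R S (p + q) := by
  obtain ⟨z, hz, rfl⟩ := mem_degreePart.1 hx
  obtain ⟨w, hw, rfl⟩ := mem_degreePart.1 hy
  refine mem_degreePart.2 ⟨z * w, fun m hm => ?_, rfl⟩
  funext σ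
  change ((z : Cochain R S) * (w : Cochain R S)) m σ = 0
  rw [Cochain.mul_apply]
  refine Finset.sum_eq_zero fun ij hij => ?_
  rw [Finset.HasAntidiagonal.mem_antidiagonal] at hij
  by_cases h : ij.1 = p
  · rw [hw ij.2 (by omega)]; exact mul_zero _
  · rw [hz ij.1 h]; exact zero_mul _

lemma pow_mem_degreePart {p : ℕ} {x : SimplicialCohomology R S}
    (hx : x ∈ degreePart R S p) (k : ℕ) : x ^ k ∈ degreePart R S (p * k) := by
  induction k with
  | zero => rw [pow_zero, mul_zero]; exact one_mem_degreePart
  | succ k ih => rw [pow_succ, mul_add, mul_one]; exact mul_mem_degreePart ih hx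

/-- The element `∑ k, a k` of `∏ n, H^n` for a sequence of classes with `a k ∈ H^{2k}`. -/
def evenTotal (a : ℕ → SimplicialCohomology R S) : SimplicialCohomology R S :=
  total fun n => if Even n then a (n / 2) else 0

lemma evenTotal_injective {a b : ℕ → SimplicialCohomology R S}
    (ha : ∀ k, a k ∈ degreePart R S (2 * k)) (hb : ∀ k, b k ∈ degreePart R S (2 * k)) :
    evenTotal a = evenTotal b ↔ a = b := by
  have key : ∀ c : ℕ → SimplicialCohomology R S, (∀ k, c k ∈ degreePart R S (2 * k)) →
      ∀ n, (if Even n then c (n / 2) else 0) ∈ degreePart R S n := by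
    intro c hc n
    split_ifs with h
    · have := hc (n / 2)
      rwa [Nat.two_mul_div_two_of_even h] at this
    · exact Submodule.zero_mem _
  rw [evenTotal, evenTotal, total_injective (key a ha) (key b hb)]
  refine ⟨fun h => ?_, fun h => h ▸ rfl⟩
  funext k
  simpa using congrFun h (2 * k)

/-- The exponential `e^x = ∑ k, x^k / k!` of a class `x ∈ H²(S; ℚ)`. -/
def expClass (x : SimplicialCohomology ℚ S) : SimplicialCohomology ℚ S :=
  evenTotal fun k => (k.factorial : ℚ)⁻¹ • x ^ k

end
end SingCoh

namespace ChernTheory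
open Bundle SingCoh CategoryTheory Opposite
open scoped LinearAlgebra.Projectivization Simplicial
universe u u' v w

noncomputable section

/-- The singular simplicial set. -/
abbrev Sing (X : Type u) [TopologicalSpace X] : SSet.{u} := TopCat.toSSet.obj (TopCat.of X)

/-- A singular simplex viewed as a continuous map on the standard topological simplex. -/
abbrev toMap {X : Type u} [TopologicalSpace X] {n : ℕ} (σ : (Sing X).obj (op ⦋n⦌)) :
    C(stdSimplex ℝ (Fin (n + 1)), X) := TopCat.toSSetObjEquiv (TopCat.of X) (op ⦋n⦌) σ

/-- The singular simplex given by a continuous map. -/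
abbrev ofMap {X : Type u} [TopologicalSpace X] {n : ℕ} (σ : C(stdSimplex ℝ (Fin (n + 1)), X)) :
    (Sing X).obj (op ⦋n⦌) := (TopCat.toSSetObjEquiv (TopCat.of X) (op ⦋n⦌)).symm σ

/-- Total singular cohomology `∏ n, H^n(X; R)` with its cup product. -/
abbrev Cohomology (R : Type v) [CommRing R] (X : Type u) [TopologicalSpace X] : Type (max u v) :=
  SimplicialCohomology R (Sing X)

/-- The map of singular sets induced by a continuous map. -/
def singMap {X : Type u} {Y : Type u'} [TopologicalSpace X] [TopologicalSpace Y] (f : C(X, Y)) :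
    SimplicialMap (Sing X) (Sing Y) where
  app k σ := (TopCat.toSSetObjEquiv (TopCat.of Y) k).symm
    (f.comp (TopCat.toSSetObjEquiv (TopCat.of X) k σ))
  naturality _ _ := rfl

/-- The pullback `f^*` in singular cohomology. -/
def cohomologyMap (R : Type v) [CommRing R] {X : Type u} {Y : Type u'} [TopologicalSpace X]
    [TopologicalSpace Y] (f : C(X, Y)) : Cohomology R Y →ₐ[R] Cohomology R X :=
  pullback (singMap f)

section Algebra

/-- The polynomial `s_k` in the elementary symmetric polynomials `e₁, …, e_n` (variable `i : Fin n`
stands for `e_{i+1}`) with `s_k(e₁(x), …, e_n(x)) = x₁^k + ⋯ + x_n^k`, which exists and is unique by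
the fundamental theorem on symmetric polynomials. -/
def powerSumInElementary (n k : ℕ) : MvPolynomial (Fin n) ℚ :=
  (MvPolynomial.esymmAlgEquiv (Fin n) ℚ (Fintype.card_fin n)).symm
    ⟨MvPolynomial.psum (Fin n) ℚ k, MvPolynomial.psum_isSymmetric (Fin n) ℚ k⟩

lemma aeval_powerSumInElementary (n k : ℕ) :
    MvPolynomial.aeval (fun i : Fin n => MvPolynomial.esymm (Fin n) ℚ (i + 1))
      (powerSumInElementary n k) = MvPolynomial.psum (Fin n) ℚ k := by
  have h := (MvPolynomial.esymmAlgEquiv (Fin n) ℚ (Fintype.card_fin n)).apply_symm_apply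
    ⟨MvPolynomial.psum (Fin n) ℚ k, MvPolynomial.psum_isSymmetric (Fin n) ℚ k⟩
  have h2 := congrArg Subtype.val h
  rw [MvPolynomial.esymmAlgEquiv_apply] at h2
  rw [powerSumInElementary]
  exact (MvPolynomial.esymmAlgHom_apply (R := ℚ) _).symm.trans h2

/-- Evaluation of a polynomial at elements `a i` of a ring, each monomial being multiplied out in
the order of the variables. Even-degree cohomology classes commute with one another, so on them the
order does not matter; fixing it makes the definition independent of that theorem. -/
def evalOrdered {A : Type*} [Ring A] [Algebra ℚ A] {n : ℕ} (a : Fin n → A)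
    (p : MvPolynomial (Fin n) ℚ) : A :=
  ∑ m ∈ p.support, p.coeff m • (List.ofFn fun i => a i ^ m i).prod

lemma evalOrdered_eq_aeval {A : Type*} [CommRing A] [Algebra ℚ A] {n : ℕ} (a : Fin n → A)
    (p : MvPolynomial (Fin n) ℚ) : evalOrdered a p = MvPolynomial.aeval a p := by
  rw [MvPolynomial.aeval_def, MvPolynomial.eval₂_eq', evalOrdered]
  refine Finset.sum_congr rfl fun m _ => ?_
  rw [List.prod_ofFn, Algebra.smul_def]

/-- If the `i`-th entry is the `i`-th elementary symmetric function of `x₁, …, x_n`, the value of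
`s_k` is the power sum `∑ j, x_j ^ k`. -/
lemma evalOrdered_powerSum {A : Type*} [CommRing A] [Algebra ℚ A] {n : ℕ} (x : Fin n → A)
    (k : ℕ) :
    evalOrdered (fun i : Fin n => MvPolynomial.aeval x (MvPolynomial.esymm (Fin n) ℚ (i + 1)))
      (powerSumInElementary n k) = ∑ j, x j ^ k := by
  rw [evalOrdered_eq_aeval]
  have h := congrArg (MvPolynomial.aeval x) (aeval_powerSumInElementary n k)
  rw [MvPolynomial.comp_aeval_apply] at h
  rw [h, MvPolynomial.psum]
  simp

end Algebra

section Geometry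
variable {B : Type u} (F : Type v) (E : B → Type w) [∀ x, AddCommGroup (E x)] [∀ x, Module ℂ (E x)]

/-- The complement `E₀` of the zero section of a bundle `E`. -/
def NonzeroVectors : Type (max u w) := {e : TotalSpace F E // e.2 ≠ 0}

/-- The projective bundle `P(E)` of lines in the fibres of `E`. -/
structure ProjBundle (F : Type v) (E : B → Type w) [∀ x, AddCommGroup (E x)]
    [∀ x, Module ℂ (E x)] : Type (max u w) where
  /-- the base point -/
  base : B
  /-- the line in the fibre -/
  line : ℙ ℂ (E base)

/-- The total space of the tautological line bundle over `P(E)`: a line and a vector on it. -/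
structure Taut : Type (max u w) where
  /-- the line -/
  pt : ProjBundle F E
  /-- the vector -/
  vec : pt.line.submodule

variable [TopologicalSpace (TotalSpace F E)]

instance : TopologicalSpace (NonzeroVectors F E) := instTopologicalSpaceSubtype

/-- The line spanned by a nonzero vector. -/
def lineThrough (e : NonzeroVectors F E) : ProjBundle F E := ⟨e.1.1, Projectivization.mk ℂ e.1.2 e.2⟩

/-- `P(E)` is the quotient space of `E₀` by the scalars. -/
instance : TopologicalSpace (ProjBundle F E) :=
  TopologicalSpace.coinduced (lineThrough F E) inferInstance

/-- The tautological line bundle as a subset of `P(E) × E`. -/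
def tautEmbedding (x : Taut F E) : ProjBundle F E × TotalSpace F E :=
  (x.pt, ⟨x.pt.base, (x.vec : E x.pt.base)⟩)

/-- The tautological line bundle has the subspace topology from `P(E) × E`. -/
instance : TopologicalSpace (Taut F E) :=
  TopologicalSpace.induced (tautEmbedding F E) inferInstance

/-- The projection of the tautological line bundle to `P(E)`. -/
def tautProj : C(Taut F E, ProjBundle F E) where
  toFun x := x.pt
  continuous_toFun := continuous_fst.comp (continuous_induced_dom (f := tautEmbedding F E))

variable [TopologicalSpace B] [NormedAddCommGroup F] [NormedSpace ℂ F]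
  [∀ x, TopologicalSpace (E x)] [FiberBundle F E] [VectorBundle ℂ F E]

/-- The projection of `P(E)` to the base. -/
def projBundleProj : C(ProjBundle F E, B) where
  toFun l := l.base
  continuous_toFun := continuous_coinduced_dom.2
    ((FiberBundle.continuous_proj F E).comp continuous_subtype_val)

/-- The affine embedding of the standard 2-simplex in `ℂ` with vertices `1, ω, ω²`, where
`ω = e^{2πi/3}`: it is orientation preserving and sends the barycentre to `0`. -/
def plane (t : stdSimplex ℝ (Fin 3)) : ℂ :=
  ∑ j : Fin 3, ((t j : ℝ) : ℂ) * Complex.exp (2 * Real.pi * Complex.I / 3) ^ (j : ℕ)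

lemma continuous_plane : Continuous plane := by
  unfold plane
  refine continuous_finsetSum _ fun j _ => ?_
  refine Continuous.mul (Complex.continuous_ofReal.comp ?_) continuous_const
  exact (continuous_apply j).comp continuous_subtype_val

/-- The singular 2-simplex `t ↦ plane t • v` in the complex line spanned by `v`. For `v ≠ 0` it is
the preferred generator of `H₂` of that line relative to the complement of `0`. -/
def fiberSimplex (x : Taut F E) : C(stdSimplex ℝ (Fin 3), Taut F E) where
  toFun t := ⟨x.pt, plane t • x.vec⟩
  continuous_toFun := by
    refine continuous_induced_rng.2 ?_
    refine Continuous.prodMk continuous_const ?_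
    let e := trivializationAt F E x.pt.base
    have hb : x.pt.base ∈ e.baseSet := FiberBundle.mem_baseSet_trivializationAt' x.pt.base
    let L := e.continuousLinearEquivAt ℂ x.pt.base hb
    have h : ∀ t : stdSimplex ℝ (Fin 3), plane t • (x.vec : E x.pt.base) = L.symm (plane t • L x.vec) := by
      intro t; rw [map_smul, L.symm_apply_apply]
    have hc : Continuous fun t : stdSimplex ℝ (Fin 3) => plane t • (x.vec : E x.pt.base) := by
      simp_rw [h]
      exact L.symm.continuous.comp (continuous_plane.smul continuous_const)
    exact (FiberBundle.continuous_totalSpaceMk F E x.pt.base).comp hc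

/-- `u` is a cocycle representing the Thom class in `H²(L, L₀; R)` of the tautological line bundle
`L`, with `L₀` the complement of the zero section: it vanishes on the simplices in `L₀`, and it takes
the value 1 on the preferred generator of every fibre (complex orientation). -/
structure IsThomCocycle (R : Type*) [CommRing R] (u : Cochain R (Sing (Taut F E))) : Prop where
  closed : u ∈ cocycles R (Sing (Taut F E))
  degree : ∀ n, n ≠ 2 → u n = 0
  relative : ∀ σ : (Sing (Taut F E)).obj (op ⦋2⦌), (∀ t, (toMap σ t).vec ≠ 0) → u 2 σ = 0
  orientation : ∀ x : Taut F E, x.vec ≠ 0 → u 2 (ofMap (fiberSimplex F E x)) = 1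

/-- `y` is the first Chern class of the tautological line bundle `q : L → P(E)`, that is, its Euler
class: `q^* y` is the image of the Thom class in `H²(L; R)`. -/
def IsTautChernClass (R : Type*) [CommRing R] (y : Cohomology R (ProjBundle F E)) : Prop :=
  y ∈ degreePart R (Sing (ProjBundle F E)) 2 ∧ ∃ u, ∃ hu : IsThomCocycle F E R u,
    cohomologyMap R (tautProj F E) y = classOf ⟨u, hu.closed⟩

/-- `c` is the sequence of Chern classes of `E`, in Grothendieck's definition: `c 0 = 1`,
`c k ∈ H^{2k}`, `c k = 0` above the rank `n`, and `∑ k, (-1)^k π^*(c k) y^{n-k} = 0` in the cohomology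
of `π : P(E) → B`, where `y` is the first Chern class of the tautological line bundle. By the
projective bundle formula there is exactly one such sequence. -/
def IsChernFamily (R : Type*) [CommRing R] (c : ℕ → Cohomology R B) : Prop :=
  c 0 = 1 ∧ (∀ k, c k ∈ degreePart R (Sing B) (2 * k)) ∧ (∀ k, Module.finrank ℂ F < k → c k = 0) ∧
  ∃ y, IsTautChernClass F E R y ∧
    ∑ k ∈ Finset.range (Module.finrank ℂ F + 1),
      (-1) ^ k * cohomologyMap R (projBundleProj F E) (c k) * y ^ (Module.finrank ℂ F - k) = 0

open Classical in
/-- The `k`-th Chern class `c_k(E) ∈ H^{2k}(B; R)`: the `k`-th term of the Chern sequence. -/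
def chernClass (R : Type*) [CommRing R] (k : ℕ) : Cohomology R B :=
  if h : ∃ c, IsChernFamily F E R c then h.choose k else if k = 0 then 1 else 0

lemma chernClass_mem (R : Type*) [CommRing R] (k : ℕ) :
    chernClass F E R k ∈ degreePart R (Sing B) (2 * k) := by
  unfold chernClass
  split_ifs with h hk
  · exact h.choose_spec.2.1 k
  · subst hk; exact one_mem_degreePart
  · exact Submodule.zero_mem _

lemma chernClass_zero (R : Type*) [CommRing R] : chernClass F E R 0 = 1 := by
  unfold chernClass
  split_ifs with h hk
  · exact h.choose_spec.1
  · rfl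
  · exact absurd rfl hk

/-- The total Chern class `c(E) = 1 + c₁(E) + c₂(E) + ⋯`. -/
def totalChernClass (R : Type*) [CommRing R] : Cohomology R B :=
  evenTotal fun k => chernClass F E R k

/-- `E` is exponential if its total Chern class, with rational coefficients, is `e^{c₁(E)}`. -/
def IsExponential : Prop :=
  totalChernClass F E ℚ = expClass (chernClass F E ℚ 1)

/-- `E` is exponential iff `c_k(E) = c₁(E)^k / k!` for all `k`. -/
lemma isExponential_iff : IsExponential F E ↔
    ∀ k : ℕ, chernClass F E ℚ k = (k.factorial : ℚ)⁻¹ • chernClass F E ℚ 1 ^ k := by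
  unfold IsExponential totalChernClass expClass
  rw [evenTotal_injective (chernClass_mem F E ℚ) fun k => Submodule.smul_mem _ _
    (pow_mem_degreePart (chernClass_mem F E ℚ 1) k)]
  exact funext_iff

/-- The Chern character `ch(E) = ∑ k, s_k(c₁(E), …, c_n(E)) / k!`, that is, `∑ j, e^{x_j}` in
the Chern roots `x_j` of `E`. -/
def chernCharacter : Cohomology ℚ B :=
  evenTotal fun k => (k.factorial : ℚ)⁻¹ •
    evalOrdered (fun i : Fin (Module.finrank ℂ F) => chernClass F E ℚ (i + 1))
      (powerSumInElementary (Module.finrank ℂ F) k)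

end Geometry
end
end ChernTheory

/-!
Write `c_k` for the Chern classes of `E`, `n` for its rank, and `p_k = s_k(c₁, …, c_n)`, so that
`ch(E) = ∑ k, p_k / k!`. Since `s_k` is weighted homogeneous of degree `k`, the class `p_k` lies in
`H^{2k}`, and `ch(E) ∈ H⁰ ⊕ H²` says that `p_k = 0` for all `k ≥ 2`
(`evenTotal_mem_degreePart_zero_sup_two_iff`). The theorem is thus the algebraic statement
`eq_pow_div_factorial_iff_evalOrdered`: `c_k = c₁^k / k!` for all `k` iff `p_k = 0` for all `k ≥ 2`.

If the `c_k` commute, this follows from Newton's identities. When `p_j = 0` for `2 ≤ j < k`, the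
identity of degree `k` collapses to `p_k = (-1)^(k+1) (k c_k - c_{k-1} c₁)`, so the vanishing of all
`p_k` with `k ≥ 2` is the recursion `k c_k = c_{k-1} c₁`, whose solution with `c₀ = 1` is
`c_k = c₁^k / k!`. For `k > n` this gives `c₁^k = 0`.

The cohomology ring is only given as an associative ring, and graded commutativity of the cup
product is not needed: either condition puts all `c_k` in the commutative subalgebra `ℚ[c₁]`. For the first
one this is clear. For the second one, if `k ≤ n`, the only term of
`s_k` containing `e_k` is `(-1)^(k+1) k e_k`, so `p_k = 0` expresses `c_k` through `c_1, …, c_{k-1}`, and induction applies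
(`mem_adjoin_of_powerSums_eq_zero`).
-/

namespace ChernTheory
open MvPolynomial

/-! ### Power sums as polynomials in the elementary symmetric polynomials -/

section PowerSums

/-- The elementary symmetric polynomial `e_k` of `n` variables as an element of `ℚ[e₁, …, e_n]`,
where variable `i : Fin n` stands for `e_{i+1}`: it is `1` for `k = 0` and `0` for `k > n`. -/
noncomputable def elementaryVar (n k : ℕ) : MvPolynomial (Fin n) ℚ :=
  if k = 0 then 1 else if h : k - 1 < n then X ⟨k - 1, h⟩ else 0

lemma elementaryVar_zero (n : ℕ) : elementaryVar n 0 = 1 := if_pos rfl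

lemma elementaryVar_succ {n : ℕ} (i : Fin n) : elementaryVar n (i + 1) = X i := by
  simp [elementaryVar]

lemma elementaryVar_of_lt {n k : ℕ} (h : n < k) : elementaryVar n k = 0 := by
  rw [elementaryVar, if_neg (by omega), dif_neg (by omega)]

lemma aeval_elementaryVar {A : Type*} [CommRing A] [Algebra ℚ A] {n : ℕ} {c : ℕ → A}
    (h0 : c 0 = 1) (hn : ∀ k, n < k → c k = 0) (k : ℕ) :
    aeval (fun i : Fin n => c (i + 1)) (elementaryVar n k) = c k := by
  rcases k with _ | k
  · rw [elementaryVar_zero, map_one, h0]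
  · by_cases hk : k < n
    · rw [show k + 1 = ((⟨k, hk⟩ : Fin n) : ℕ) + 1 from rfl, elementaryVar_succ, aeval_X]
    · rw [elementaryVar_of_lt (by omega), map_zero, hn _ (by omega)]

lemma aeval_esymm_injective (n : ℕ) : Function.Injective
    (aeval (R := ℚ) fun i : Fin n => esymm (Fin n) ℚ (i + 1)) := by
  intro p q h
  refine esymmAlgHom_injective (σ := Fin n) ℚ (Fintype.card_fin n).ge (Subtype.ext ?_)
  rw [esymmAlgHom_apply, esymmAlgHom_apply]
  exact h

/-- Newton's identities, as identities between polynomials in the elementary symmetric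
polynomials. -/
lemma powerSumInElementary_eq (n : ℕ) {k : ℕ} (hk : 0 < k) :
    powerSumInElementary n k = (-1) ^ (k + 1) * k * elementaryVar n k -
      ∑ a ∈ Finset.HasAntidiagonal.antidiagonal k with a.1 ∈ Set.Ioo 0 k,
        (-1) ^ a.1 * elementaryVar n a.1 * powerSumInElementary n a.2 := by
  have hE : ∀ j, aeval (R := ℚ) (fun i : Fin n => esymm (Fin n) ℚ (i + 1)) (elementaryVar n j) =
      esymm (Fin n) ℚ j := by
    refine aeval_elementaryVar (c := esymm (Fin n) ℚ) (esymm_zero _ _) fun j hj => ?_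
    rw [esymm, Finset.powersetCard_eq_empty.2 (by simpa using hj), Finset.sum_empty]
  apply aeval_esymm_injective
  simp only [map_sub, map_sum, map_mul, map_pow, map_neg, map_one, map_natCast, hE,
    aeval_powerSumInElementary]
  exact psum_eq_mul_esymm_sub_sum (Fin n) ℚ k hk

lemma isWeightedHomogeneous_elementaryVar (n k : ℕ) :
    IsWeightedHomogeneous (fun i : Fin n => (i : ℕ) + 1) (elementaryVar n k) k := by
  rcases k with _ | k
  · rw [elementaryVar_zero]; exact isWeightedHomogeneous_one _ _
  · by_cases hk : k < n
    · rw [show k + 1 = ((⟨k, hk⟩ : Fin n) : ℕ) + 1 from rfl, elementaryVar_succ]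
      exact isWeightedHomogeneous_X _ _ _
    · rw [elementaryVar_of_lt (by omega)]; exact isWeightedHomogeneous_zero _ _ _

/-- `s_k` is homogeneous of degree `k` when the variable standing for `e_j` has weight `j`. -/
lemma isWeightedHomogeneous_powerSumInElementary (n k : ℕ) :
    IsWeightedHomogeneous (fun i : Fin n => (i : ℕ) + 1) (powerSumInElementary n k) k := by
  induction k using Nat.strong_induction_on with
  | _ k ih =>
    rcases Nat.eq_zero_or_pos k with rfl | hk
    · have h : powerSumInElementary n 0 = C (n : ℚ) := by
        apply aeval_esymm_injective
        rw [aeval_powerSumInElementary, psum]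
        simp
      rw [h]
      exact isWeightedHomogeneous_C _ _
    · have hC : ∀ m : ℕ, (-1 : MvPolynomial (Fin n) ℚ) ^ m = C ((-1) ^ m) := by simp
      rw [powerSumInElementary_eq n hk]
      refine IsWeightedHomogeneous.sub ?_ (IsWeightedHomogeneous.sum _ _ _ fun a ha => ?_)
      · rw [hC, ← C_eq_coe_nat, ← C_mul]
        exact (isWeightedHomogeneous_elementaryVar n k).C_mul _
      · rw [Finset.mem_filter, Finset.HasAntidiagonal.mem_antidiagonal, Set.mem_Ioo] at ha
        rw [hC, ← ha.1]
        exact ((isWeightedHomogeneous_elementaryVar n _).C_mul _).mul (ih _ (by omega))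

end PowerSums

/-! ### Ordered evaluation in a noncommutative ring -/

section OrderedEvaluation

variable {A : Type*} [Ring A] [Algebra ℚ A] {n : ℕ} (a : Fin n → A)

/-- The sum defining `evalOrdered` may be taken over any finite set containing the support. -/
lemma evalOrdered_eq_sum {p : MvPolynomial (Fin n) ℚ} {s : Finset (Fin n →₀ ℕ)}
    (h : p.support ⊆ s) :
    evalOrdered a p = ∑ m ∈ s, p.coeff m • (List.ofFn fun i => a i ^ m i).prod :=
  Finset.sum_subset h fun m _ hm => by rw [notMem_support_iff.1 hm, zero_smul]

lemma evalOrdered_sub (p q : MvPolynomial (Fin n) ℚ) :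
    evalOrdered a (p - q) = evalOrdered a p - evalOrdered a q := by
  classical
  rw [evalOrdered_eq_sum a (support_sub (Fin n) p q),
    evalOrdered_eq_sum a (Finset.subset_union_left (s₂ := q.support)),
    evalOrdered_eq_sum a (Finset.subset_union_right (s₁ := p.support)),
    ← Finset.sum_sub_distrib]
  simp only [coeff_sub, sub_smul]

lemma evalOrdered_C_mul_X (r : ℚ) (i : Fin n) : evalOrdered a (C r * X i) = r • a i := by
  classical
  rw [C_mul_X_eq_monomial, evalOrdered_eq_sum a support_monomial_subset, Finset.sum_singleton,
    coeff_monomial, if_pos rfl]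
  -- The number of variables varies here, so that the product can be split at its first factor.
  have h : ∀ (m : ℕ) (b : Fin m → A) (j : Fin m),
      (List.ofFn fun l => b l ^ (Finsupp.single j 1 : Fin m →₀ ℕ) l).prod = b j := by
    intro m
    induction m with
    | zero => exact fun _ j => j.elim0
    | succ m ih =>
      intro b j
      rw [List.ofFn_succ, List.prod_cons]
      refine Fin.cases ?_ (fun j => ?_) j
      · simp
      · have := ih (fun l => b l.succ) j
        simp only [Finsupp.single_apply, Fin.succ_inj] at this ⊢
        rw [if_neg (Fin.succ_ne_zero j), pow_zero, one_mul]
        exact this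
  rw [h]

lemma map_evalOrdered {A' : Type*} [Ring A'] [Algebra ℚ A'] (f : A →ₐ[ℚ] A')
    (p : MvPolynomial (Fin n) ℚ) : f (evalOrdered a p) = evalOrdered (fun i => f (a i)) p := by
  simp only [evalOrdered, map_sum, map_smul, map_list_prod, List.map_ofFn, Function.comp_def,
    map_pow]

lemma evalOrdered_mem (S : Subalgebra ℚ A) {p : MvPolynomial (Fin n) ℚ}
    (h : ∀ i ∈ p.vars, a i ∈ S) : evalOrdered a p ∈ S := by
  refine Subalgebra.sum_mem _ fun m hm => S.smul_mem (Subalgebra.list_prod_mem _ fun x hx => ?_) _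
  obtain ⟨i, rfl⟩ := (List.mem_ofFn' _ _).1 hx
  by_cases hi : m i = 0
  · simp only [hi, pow_zero]; exact S.one_mem
  · exact S.pow_mem (h i ((mem_vars_iff_mem_support i).2 ⟨m, hm, Finsupp.mem_support_iff.2 hi⟩)) _

end OrderedEvaluation

/-! ### Vanishing power sums and the exponential recursion -/

section ExponentialSequences

lemma lt_of_mem_vars {n k : ℕ} {p : MvPolynomial (Fin n) ℚ}
    (hp : IsWeightedHomogeneous (fun i : Fin n => (i : ℕ) + 1) p k) {i : Fin n}
    (hi : i ∈ p.vars) : (i : ℕ) < k := by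
  obtain ⟨m, hm, him⟩ := (mem_vars_iff_mem_support i).1 hi
  rw [← hp (mem_support_iff.1 hm)]
  exact Finsupp.le_weight_of_ne_zero' (fun i : Fin n => (i : ℕ) + 1) (Finsupp.mem_support_iff.1 him)

variable {A : Type*} {n : ℕ} {c : ℕ → A}

/-- If the power sums of degree at least `2` vanish at `c₁, …, c_n`, then each `c_k` is a polynomial
in `c₁`. No commutativity is assumed: `c_k` occurs in `s_k` only in a linear term, which stays clear
of the order of multiplication, and all other terms involve lower variables only. -/
lemma mem_adjoin_of_powerSums_eq_zero [Ring A] [Algebra ℚ A] (h0 : c 0 = 1)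
    (hn : ∀ k, n < k → c k = 0)
    (hs : ∀ k, 2 ≤ k → evalOrdered (fun i : Fin n => c (i + 1)) (powerSumInElementary n k) = 0)
    (k : ℕ) : c k ∈ Algebra.adjoin ℚ {c 1} := by
  induction k using Nat.strong_induction_on with
  | _ k ih =>
    obtain rfl | rfl | hk : k = 0 ∨ k = 1 ∨ 2 ≤ k := by omega
    · rw [h0]; exact Subalgebra.one_mem _
    · exact Algebra.subset_adjoin rfl
    by_cases hkn : n < k
    · rw [hn k hkn]; exact Subalgebra.zero_mem _
    -- For `2 ≤ k ≤ n`, Newton's identity solves `s_k = 0` for `c_k`.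
    obtain ⟨i, rfl⟩ : ∃ i : Fin n, k = i + 1 := ⟨⟨k - 1, by omega⟩, by simp; omega⟩
    have h := hs _ hk
    rw [powerSumInElementary_eq n (by omega), evalOrdered_sub, sub_eq_zero, elementaryVar_succ,
      show ((-1) ^ ((i : ℕ) + 1 + 1) * ((i + 1 : ℕ) : MvPolynomial (Fin n) ℚ)) =
        C ((-1) ^ ((i : ℕ) + 1 + 1) * ((i + 1 : ℕ) : ℚ)) by simp, evalOrdered_C_mul_X] at h
    have hr : ((-1) ^ ((i : ℕ) + 1 + 1) * ((i + 1 : ℕ) : ℚ)) ≠ 0 :=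
      mul_ne_zero (pow_ne_zero _ (by norm_num)) (by positivity)
    rw [← inv_smul_smul₀ hr (c (i + 1)), h]
    refine Subalgebra.smul_mem _ (evalOrdered_mem _ _ fun j hj => ih _ ?_) _
    obtain ⟨b, hb, hjb⟩ := Finset.mem_biUnion.1 (vars_sum_subset _ _ hj)
    rw [Finset.mem_filter, Finset.HasAntidiagonal.mem_antidiagonal, Set.mem_Ioo] at hb
    rcases Finset.mem_union.1 (vars_mul _ _ hjb) with h' | h'
    · have := lt_of_mem_vars (((isWeightedHomogeneous_elementaryVar n b.1).C_mul ((-1) ^ b.1)))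
        (by simpa using h')
      omega
    · have := lt_of_mem_vars (isWeightedHomogeneous_powerSumInElementary n b.2) h'
      omega

/-- If the power sums of degrees `2, …, k - 1` vanish, only the terms with `e_k` and with
`e_{k-1} p₁ = e_{k-1} e₁` survive in Newton's identity of degree `k`. -/
lemma aeval_powerSumInElementary_of_lower_eq_zero [CommRing A] [Algebra ℚ A] (h0 : c 0 = 1)
    (hn : ∀ k, n < k → c k = 0) {k : ℕ} (hk : 2 ≤ k)
    (hs : ∀ j, 2 ≤ j → j < k →
      aeval (fun i : Fin n => c (i + 1)) (powerSumInElementary n j) = 0) :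
    aeval (fun i : Fin n => c (i + 1)) (powerSumInElementary n k) =
      (-1) ^ (k + 1) * (k * c k - c (k - 1) * c 1) := by
  have newton : ∀ m, 0 < m → aeval (fun i : Fin n => c (i + 1)) (powerSumInElementary n m) =
      (-1) ^ (m + 1) * m * c m - ∑ b ∈ Finset.HasAntidiagonal.antidiagonal m with b.1 ∈ Set.Ioo 0 m,
        (-1) ^ b.1 * c b.1 * aeval (fun i : Fin n => c (i + 1)) (powerSumInElementary n b.2) := by
    intro m hm
    rw [powerSumInElementary_eq n hm]
    simp only [map_sub, map_sum, map_mul, map_pow, map_neg, map_one, map_natCast,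
      aeval_elementaryVar h0 hn]
  have h1 : aeval (fun i : Fin n => c (i + 1)) (powerSumInElementary n 1) = c 1 := by
    rw [newton 1 one_pos, Finset.sum_eq_zero]
    · simp
    · intro b hb
      rw [Finset.mem_filter, Set.mem_Ioo] at hb
      omega
  obtain ⟨k, rfl⟩ : ∃ l, k = l + 1 := ⟨k - 1, by omega⟩
  rw [newton _ (by omega), Finset.sum_eq_single (k, 1)]
  · rw [h1, Nat.add_sub_cancel]
    ring
  · rintro ⟨b, b'⟩ hb hne
    rw [Finset.mem_filter, Finset.HasAntidiagonal.mem_antidiagonal, Set.mem_Ioo] at hb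
    rw [hs _ _ (by omega), mul_zero]
    rw [Ne, Prod.mk.injEq] at hne
    omega
  · intro h
    refine absurd ?_ h
    rw [Finset.mem_filter, Finset.HasAntidiagonal.mem_antidiagonal, Set.mem_Ioo]
    omega

lemma eq_pow_div_factorial_iff_aeval [CommRing A] [Algebra ℚ A] (h0 : c 0 = 1)
    (hn : ∀ k, n < k → c k = 0) :
    (∀ k : ℕ, c k = (k.factorial : ℚ)⁻¹ • c 1 ^ k) ↔
      ∀ k, 2 ≤ k → aeval (fun i : Fin n => c (i + 1)) (powerSumInElementary n k) = 0 := by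
  have hfac : ∀ k : ℕ, ((k + 1 : ℕ) : ℚ) * ((k + 1).factorial : ℚ)⁻¹ = (k.factorial : ℚ)⁻¹ := by
    intro k
    have : ((k + 1 : ℕ) : ℚ) ≠ 0 := by positivity
    rw [Nat.factorial_succ, Nat.cast_mul, mul_inv, mul_inv_cancel_left₀ this]
  have hcast : ∀ (k : ℕ) (x : A), (k : A) * x = (k : ℚ) • x := by
    intro k x
    rw [Algebra.smul_def, map_natCast]
  constructor
  · intro h k
    induction k using Nat.strong_induction_on with
    | _ k ih =>
      intro hk
      rw [aeval_powerSumInElementary_of_lower_eq_zero h0 hn hk fun j hj hjk => ih j hjk hj]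
      obtain ⟨k, rfl⟩ : ∃ l, k = l + 1 := ⟨k - 1, by omega⟩
      rw [hcast, h (k + 1), Nat.add_sub_cancel, h k, smul_smul, hfac, smul_mul_assoc,
        ← pow_succ, sub_self, mul_zero]
  · intro h k
    induction k with
    | zero => simp [h0]
    | succ k ih =>
      rcases Nat.eq_zero_or_pos k with rfl | hk
      · simp
      have hN := aeval_powerSumInElementary_of_lower_eq_zero h0 hn (show 2 ≤ k + 1 by omega)
        fun j hj _ => h j hj
      rw [h _ (by omega), Nat.add_sub_cancel, eq_comm,
        (isUnit_one.neg.pow _).mul_right_eq_zero, sub_eq_zero, hcast, ih] at hN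
      have hk0 : ((k + 1 : ℕ) : ℚ) ≠ 0 := by positivity
      rw [← inv_smul_smul₀ hk0 (c (k + 1)), hN, ← hfac, pow_succ, smul_mul_assoc, smul_smul,
        inv_mul_cancel_left₀ hk0]

open scoped IsMulCommutative in
/-- Transfer of the commutative case to families in a commutative subalgebra of an arbitrary
algebra. -/
lemma eq_pow_div_factorial_iff_of_mem [Ring A] [Algebra ℚ A] (T : Subalgebra ℚ A)
    [IsMulCommutative T] (hT : ∀ k, c k ∈ T) (h0 : c 0 = 1) (hn : ∀ k, n < k → c k = 0) :
    (∀ k : ℕ, c k = (k.factorial : ℚ)⁻¹ • c 1 ^ k) ↔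
      ∀ k, 2 ≤ k → evalOrdered (fun i : Fin n => c (i + 1)) (powerSumInElementary n k) = 0 := by
  obtain ⟨b, rfl⟩ : ∃ b : ℕ → T, (fun k => T.val (b k)) = c := ⟨fun k => ⟨c k, hT k⟩, rfl⟩
  have hinj : Function.Injective T.val := Subtype.val_injective
  have hb := eq_pow_div_factorial_iff_aeval (n := n) (c := b) (hinj (h0.trans (map_one _).symm))
    fun k hk => hinj ((hn k hk).trans (map_zero _).symm)
  simp only [← map_evalOrdered (fun i : Fin n => b (i + 1)) T.val, ← map_pow, ← map_smul,
    map_eq_zero_iff _ hinj, hinj.eq_iff, evalOrdered_eq_aeval]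
  exact hb

/-- The commutative case carries over to arbitrary algebras, because either side of the equivalence
forces every `c k` into the commutative subalgebra generated by `c 1`. -/
lemma eq_pow_div_factorial_iff_evalOrdered [Ring A] [Algebra ℚ A] (h0 : c 0 = 1)
    (hn : ∀ k, n < k → c k = 0) :
    (∀ k : ℕ, c k = (k.factorial : ℚ)⁻¹ • c 1 ^ k) ↔
      ∀ k, 2 ≤ k → evalOrdered (fun i : Fin n => c (i + 1)) (powerSumInElementary n k) = 0 := by
  have key (hmem : ∀ k, c k ∈ Algebra.adjoin ℚ {c 1}) :=
    eq_pow_div_factorial_iff_of_mem (n := n) (Algebra.adjoin ℚ {c 1}) hmem h0 hn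
  refine ⟨fun h => ?_, fun h => (key (mem_adjoin_of_powerSums_eq_zero h0 hn h)).2 h⟩
  have hmem (k : ℕ) : c k ∈ Algebra.adjoin ℚ {c 1} := by
    have hk : (k.factorial : ℚ)⁻¹ • c 1 ^ k ∈ Algebra.adjoin ℚ {c 1} :=
      Subalgebra.smul_mem _ (Subalgebra.pow_mem _ (Algebra.self_mem_adjoin_singleton ℚ (c 1)) _) _
    rwa [← h k] at hk
  exact (key hmem).1 h

end ExponentialSequences

/-! ### Degrees of cohomology classes -/

section Degrees
open SingCoh
universe u v
variable {R : Type v} [CommRing R] {S : SSet.{u}}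

lemma list_prod_mem_degreePart {m : ℕ} {x : Fin m → SimplicialCohomology R S} {g : Fin m → ℕ}
    (h : ∀ i, x i ∈ degreePart R S (g i)) : (List.ofFn x).prod ∈ degreePart R S (∑ i, g i) := by
  induction m with
  | zero => simpa using one_mem_degreePart
  | succ m ih =>
    rw [List.ofFn_succ, List.prod_cons, Fin.sum_univ_succ]
    exact mul_mem_degreePart (h 0) (ih fun i => h i.succ)

lemma evalOrdered_mem_degreePart {n k : ℕ} {a : Fin n → SimplicialCohomology ℚ S}
    (ha : ∀ i : Fin n, a i ∈ degreePart ℚ S (2 * (i + 1))) {p : MvPolynomial (Fin n) ℚ}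
    (hp : IsWeightedHomogeneous (fun i : Fin n => (i : ℕ) + 1) p k) :
    evalOrdered a p ∈ degreePart ℚ S (2 * k) := by
  refine Submodule.sum_mem _ fun m hm => Submodule.smul_mem _ _ ?_
  have hk : 2 * k = ∑ i : Fin n, 2 * (i + 1) * m i := by
    rw [← hp (mem_support_iff.1 hm), Finsupp.weight_apply, Finsupp.sum_fintype _ _ (by simp),
      Finset.mul_sum]
    refine Finset.sum_congr rfl fun i _ => ?_
    rw [smul_eq_mul]
    ring
  rw [hk]
  exact list_prod_mem_degreePart fun i => pow_mem_degreePart (ha i) _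

lemma add_eq_evenTotal {x y : SimplicialCohomology R S} (hx : x ∈ degreePart R S 0)
    (hy : y ∈ degreePart R S 2) :
    x + y = evenTotal fun k => if k = 0 then x else if k = 1 then y else 0 := by
  obtain ⟨z, hz, rfl⟩ := mem_degreePart.1 hx
  obtain ⟨w, hw, rfl⟩ := mem_degreePart.1 hy
  have h : (fun n => if Even n then (if n / 2 = 0 then classOf z else if n / 2 = 1 then classOf w
      else 0) else 0 : ℕ → SimplicialCohomology R S) =
      fun n => classOf (if n = 0 then z else if n = 2 then w else 0) := by
    funext n
    by_cases h0 : n = 0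
    · subst h0; simp
    by_cases h2 : n = 2
    · subst h2; simp
    rw [if_neg h0, if_neg h2, map_zero]
    split_ifs with h1 h3 h4
    · rcases h1 with ⟨r, rfl⟩; omega
    · rcases h1 with ⟨r, rfl⟩; omega
    · rfl
    · rfl
  rw [evenTotal, h, total_classOf, ← map_add]
  congr 1
  refine Subtype.ext (funext fun n => ?_)
  change (z : Cochain R S) n + (w : Cochain R S) n =
    ((if n = 0 then z else if n = 2 then w else 0 : cocycles R S) : Cochain R S) n
  split_ifs with h0 h2
  · rw [hw n (by omega), add_zero]
  · rw [hz n h0, zero_add]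
  · rw [hz n h0, hw n h2, add_zero]; rfl

lemma evenTotal_mem_degreePart_zero_sup_two_iff {a : ℕ → SimplicialCohomology R S}
    (ha : ∀ k, a k ∈ degreePart R S (2 * k)) :
    evenTotal a ∈ degreePart R S 0 ⊔ degreePart R S 2 ↔ ∀ k, 2 ≤ k → a k = 0 := by
  rw [Submodule.mem_sup]
  constructor
  · rintro ⟨x, hx, y, hy, h⟩ k hk
    rw [add_eq_evenTotal hx hy, evenTotal_injective _ ha] at h
    · rw [← h]
      dsimp only
      rw [if_neg (by omega), if_neg (by omega)]
    · intro k
      split_ifs with h0 h1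
      · subst h0; exact hx
      · subst h1; exact hy
      · exact Submodule.zero_mem _
  · intro h
    refine ⟨a 0, ha 0, a 1, ha 1, ?_⟩
    rw [add_eq_evenTotal (ha 0) (ha 1)]
    congr 1
    funext k
    split_ifs with h0 h1
    · rw [h0]
    · rw [h1]
    · exact (h k (by omega)).symm

end Degrees

/-! ### Chern classes above the rank -/

section Geometry
universe u v w
variable {B : Type u} (F : Type v) (E : B → Type w) [∀ x, AddCommGroup (E x)] [∀ x, Module ℂ (E x)]
  [TopologicalSpace (Bundle.TotalSpace F E)] [TopologicalSpace B] [NormedAddCommGroup F]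
  [NormedSpace ℂ F] [∀ x, TopologicalSpace (E x)] [FiberBundle F E] [VectorBundle ℂ F E]

/-- Both branches of the definition of `chernClass` vanish above the rank: a Chern family does so by
definition, and the default value is zero in positive degrees. -/
lemma chernClass_eq_zero_of_finrank_lt (R : Type*) [CommRing R] {k : ℕ}
    (hk : Module.finrank ℂ F < k) : chernClass F E R k = 0 := by
  unfold chernClass
  split_ifs with h h0
  · exact h.choose_spec.2.2.1 k hk
  · omega
  · rfl

end Geometry

end ChernTheory

theorem mainTheorem8 {B : Type*} [TopologicalSpace B] (F : Type*) [NormedAddCommGroup F]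
    [NormedSpace ℂ F] [FiniteDimensional ℂ F] (E : B → Type*) [∀ x, AddCommGroup (E x)]
    [∀ x, Module ℂ (E x)] [∀ x, TopologicalSpace (E x)] [TopologicalSpace (Bundle.TotalSpace F E)]
    [FiberBundle F E] [VectorBundle ℂ F E] :
    ChernTheory.IsExponential F E ↔
      ChernTheory.chernCharacter F E ∈
        SingCoh.degreePart ℚ (ChernTheory.Sing B) 0 ⊔ SingCoh.degreePart ℚ (ChernTheory.Sing B) 2 := by
  rw [ChernTheory.isExponential_iff, ChernTheory.chernCharacter,
    ChernTheory.evenTotal_mem_degreePart_zero_sup_two_iff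
    fun k => Submodule.smul_mem _ _ (ChernTheory.evalOrdered_mem_degreePart
      (fun i => ChernTheory.chernClass_mem F E ℚ (i + 1))
      (ChernTheory.isWeightedHomogeneous_powerSumInElementary _ k)),
    ChernTheory.eq_pow_div_factorial_iff_evalOrdered (ChernTheory.chernClass_zero F E ℚ)
      fun k hk => ChernTheory.chernClass_eq_zero_of_finrank_lt F E ℚ hk]
  refine forall₂_congr fun k _ => ?_
  rw [smul_eq_zero_iff_right (inv_ne_zero (Nat.cast_ne_zero.2 k.factorial_ne_zero))]
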